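/- Let $\mathbb{K}$ be a field of characteristic zero, let $n\ge 1$, and let $W$ be the Weyl algebra over $\mathbb{K}$, i.e. the associative unital algebra generated by $p_1,q_1,\dots,p_n,q_n$ with relations $p_iq_j-q_jp_i=\delta_{ij}$, $p_ip_j-p_jp_i=q_iq_j-q_jq_i=0$ for $1\le i,j\le n$. Give $W$ the $\mathbb{Z}_2$-grading $W=W_{\bar 0}\oplus W_{\bar 1}$ for which all $p_i$ and $q_i$ are odd, and the Lie superalgebra structure with bracket $[F,G]=FG-(-1)^{fg}GF$ for $F\in W_f$, $G\in W_g$. Let $[W,W]$ be the linear span of all brackets, with the induced Lie superalgebra structure. A Lie superalgebra $L=L_{\bar 0}\oplus L_{\bar 1}$ is called superquadratic if there is a non-degenerate bilinear form $B$ on $L$ that is even ($B(L_{\bar 0},L_{\bar 1})=B(L_{\bar 1},L_{\bar 0})=0$), supersymmetric ($B(y,x)=(-1)^{ab}B(x,y)$ for $x\in L_a$, $y\in L_b$) and invariant under the adjoint representation ($B([x,y],z)+(-1)^{ab}B(y,[x,z])=0$ for $x\in L_a$, $y\in L_b$, $z\in L$). It is called simple if its bracket is not identically zero and the only subspaces $I\subseteq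 L$ (homogeneous or not) with $[L,I]\subseteq I$ are $\{0\}$ and $L$. Then $W$ and $[W,W]$ are superquadratic Lie superalgebras, and $[W,W]$ is a simple Lie superalgebra. In particular, $[W,W]$ is a simple superquadratic Lie superalgebra. -/

import Mathlib

open scoped DirectSum

/-- A Lie superalgebra structure on the `K`-vector space `V`: a `ℤ/2`-grading `V = V₀ ⊕ V₁` and
a bilinear bracket which respects the grading, is super-antisymmetric,
`[x, y] = -(-1)^{|x||y|} [y, x]`, and satisfies the super Jacobi identity
`[x, [y, z]] = [[x, y], z] + (-1)^{|x||y|} [y, [x, z]]` (in the last identity `z` may be arbitrary,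
since no sign depends on its parity). -/
structure LieSuperalgebra (K V : Type*) [Field K] [AddCommGroup V] [Module K V] where
  /-- the even part (index `0`) and the odd part (index `1`) -/
  grading : ZMod 2 → Submodule K V
  isCompl : IsCompl (grading 0) (grading 1)
  /-- the super bracket -/
  bracket : V →ₗ[K] V →ₗ[K] V
  bracket_mem : ∀ {i j : ZMod 2} {x y : V}, x ∈ grading i → y ∈ grading j →
    bracket x y ∈ grading (i + j)
  bracket_skew : ∀ {i j : ZMod 2} {x y : V}, x ∈ grading i → y ∈ grading j →
    bracket x y = -((-1 : K) ^ (i.val * j.val) • bracket y x)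
  jacobi : ∀ {i j : ZMod 2} {x y : V} (z : V), x ∈ grading i → y ∈ grading j →
    bracket x (bracket y z) =
      bracket (bracket x y) z + (-1 : K) ^ (i.val * j.val) • bracket y (bracket x z)

namespace LieSuperalgebra

section Basic

variable {K V : Type*} [Field K] [AddCommGroup V] [Module K V] (L : LieSuperalgebra K V)

/-- The bilinear form `B` is even: the even and the odd part are orthogonal to each other. -/
def IsEvenForm (B : V →ₗ[K] V →ₗ[K] K) : Prop :=
  ∀ ⦃i j : ZMod 2⦄ ⦃x y : V⦄, x ∈ L.grading i → y ∈ L.grading j → i ≠ j → B x y = 0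

/-- The bilinear form `B` is supersymmetric: `B(y, x) = (-1)^{|x||y|} B(x, y)`. -/
def IsSupersymmetric (B : V →ₗ[K] V →ₗ[K] K) : Prop :=
  ∀ ⦃i j : ZMod 2⦄ ⦃x y : V⦄, x ∈ L.grading i → y ∈ L.grading j →
    B y x = (-1 : K) ^ (i.val * j.val) * B x y

/-- The bilinear form `B` is invariant under the adjoint representation:
`B([x, y], z) + (-1)^{|x||y|} B(y, [x, z]) = 0`. -/
def IsInvariant (B : V →ₗ[K] V →ₗ[K] K) : Prop :=
  ∀ ⦃i j : ZMod 2⦄ ⦃x y : V⦄ (z : V), x ∈ L.grading i → y ∈ L.grading j →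
    B (L.bracket x y) z + (-1 : K) ^ (i.val * j.val) * B y (L.bracket x z) = 0

/-- A Lie superalgebra is superquadratic if it has a non-degenerate invariant supersymmetric
(even) bilinear form. -/
def IsSuperquadratic : Prop :=
  ∃ B : V →ₗ[K] V →ₗ[K] K,
    LinearMap.Nondegenerate B ∧ L.IsEvenForm B ∧ L.IsSupersymmetric B ∧ L.IsInvariant B

/-- A Lie superalgebra `L` is simple if its bracket is not identically zero and the only
ad-stable subspaces are `0` and `L`. The subspaces are not required to be homogeneous, so this
rules out non-trivial ideals both in the graded and in the ungraded sense. -/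
def IsSimple : Prop :=
  (∃ x y : V, L.bracket x y ≠ 0) ∧
    ∀ I : Submodule K V, (∀ x : V, ∀ y ∈ I, L.bracket x y ∈ I) → I = ⊥ ∨ I = ⊤

/-- The underlying subspace of `[L, L]`: the linear span of all brackets. -/
def derivedSubmodule : Submodule K V :=
  Submodule.span K {z | ∃ x y : V, L.bracket x y = z}

lemma bracket_mem_derivedSubmodule (x y : V) : L.bracket x y ∈ L.derivedSubmodule :=
  Submodule.subset_span ⟨x, y, rfl⟩

lemma exists_add (x : V) : ∃ a ∈ L.grading 0, ∃ b ∈ L.grading 1, a + b = x :=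
  Submodule.mem_sup.1 (L.isCompl.sup_eq_top ▸ Submodule.mem_top : x ∈ L.grading 0 ⊔ L.grading 1)

lemma exists_add_of_mem_derivedSubmodule {x : V} (hx : x ∈ L.derivedSubmodule) :
    ∃ a ∈ L.grading 0 ⊓ L.derivedSubmodule, ∃ b ∈ L.grading 1 ⊓ L.derivedSubmodule,
      a + b = x := by
  rw [← Submodule.mem_sup]
  refine (Submodule.span_le (p := L.grading 0 ⊓ L.derivedSubmodule ⊔
    L.grading 1 ⊓ L.derivedSubmodule)).2 ?_ hx
  rintro _ ⟨x, y, rfl⟩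
  obtain ⟨a, ha, b, hb, rfl⟩ := L.exists_add x
  obtain ⟨c, hc, d, hd, rfl⟩ := L.exists_add y
  have h00 := L.bracket_mem ha hc
  have h01 := L.bracket_mem ha hd
  have h10 := L.bracket_mem hb hc
  have h11 : L.bracket b d ∈ L.grading 0 := L.bracket_mem hb hd
  rw [add_zero] at h00 h10
  rw [zero_add] at h01
  simp only [map_add, LinearMap.add_apply]
  exact add_mem
    (add_mem (Submodule.mem_sup_left ⟨h00, L.bracket_mem_derivedSubmodule a c⟩)
      (Submodule.mem_sup_right ⟨h10, L.bracket_mem_derivedSubmodule b c⟩))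
    (add_mem (Submodule.mem_sup_right ⟨h01, L.bracket_mem_derivedSubmodule a d⟩)
      (Submodule.mem_sup_left ⟨h11, L.bracket_mem_derivedSubmodule b d⟩))

/-- The Lie superalgebra `[L, L]`, with the grading and the bracket induced by those of `L`. -/
def derived : LieSuperalgebra K L.derivedSubmodule where
  grading i := (L.grading i).comap L.derivedSubmodule.subtype
  isCompl := by
    constructor
    · rw [Submodule.disjoint_def]
      intro x h0 h1
      exact Subtype.ext (Submodule.disjoint_def.1 L.isCompl.disjoint x h0 h1)
    · rw [codisjoint_iff, eq_top_iff]
      rintro ⟨x, hx⟩ -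
      obtain ⟨a, ha, b, hb, hab⟩ := L.exists_add_of_mem_derivedSubmodule hx
      exact Submodule.mem_sup.2 ⟨⟨a, ha.2⟩, ha.1, ⟨b, hb.2⟩, hb.1, Subtype.ext hab⟩
  bracket := LinearMap.mk₂ K
    (fun x y => ⟨L.bracket x y, L.bracket_mem_derivedSubmodule x y⟩)
    (fun _ _ _ => Subtype.ext (by simp)) (fun _ _ _ => Subtype.ext (by simp))
    (fun _ _ _ => Subtype.ext (by simp)) (fun _ _ _ => Subtype.ext (by simp))
  bracket_mem hx hy := L.bracket_mem hx hy
  bracket_skew hx hy := Subtype.ext (L.bracket_skew hx hy)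
  jacobi z hx hy := Subtype.ext (L.jacobi (z : V) hx hy)

end Basic

/-- The super commutator of a `ℤ/2`-graded associative algebra: the bilinear map with
`[x, y] = x y - (-1)^{|x||y|} y x` for homogeneous `x` and `y`. -/
noncomputable def superCommutator {K A : Type*} [Field K] [Ring A] [Algebra K A]
    (𝒜 : ZMod 2 → Submodule K A) [GradedAlgebra 𝒜] : A →ₗ[K] A →ₗ[K] A :=
  ∑ i : ZMod 2, ∑ j : ZMod 2,
    ((LinearMap.mul K A).compl₁₂ (GradedAlgebra.proj 𝒜 i) (GradedAlgebra.proj 𝒜 j) -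
      (-1 : K) ^ (i.val * j.val) •
        (LinearMap.mul K A).flip.compl₁₂ (GradedAlgebra.proj 𝒜 i) (GradedAlgebra.proj 𝒜 j))

lemma superCommutator_apply {K A : Type*} [Field K] [Ring A] [Algebra K A]
    (𝒜 : ZMod 2 → Submodule K A) [GradedAlgebra 𝒜] {i j : ZMod 2} {x y : A}
    (hx : x ∈ 𝒜 i) (hy : y ∈ 𝒜 j) :
    superCommutator 𝒜 x y = x * y - (-1 : K) ^ (i.val * j.val) • (y * x) := by
  have hX : ∀ k, GradedAlgebra.proj 𝒜 k x = if k = i then x else 0 := by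
    intro k
    rw [GradedAlgebra.proj_apply]
    split_ifs with h
    · subst h; exact DirectSum.decompose_of_mem_same 𝒜 hx
    · exact DirectSum.decompose_of_mem_ne 𝒜 hx (Ne.symm h)
  have hY : ∀ k, GradedAlgebra.proj 𝒜 k y = if k = j then y else 0 := by
    intro k
    rw [GradedAlgebra.proj_apply]
    split_ifs with h
    · subst h; exact DirectSum.decompose_of_mem_same 𝒜 hy
    · exact DirectSum.decompose_of_mem_ne 𝒜 hy (Ne.symm h)
  simp only [superCommutator, LinearMap.sum_apply, LinearMap.sub_apply, LinearMap.smul_apply,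
    LinearMap.compl₁₂_apply, LinearMap.flip_apply, LinearMap.mul_apply', hX, hY]
  rw [Finset.sum_eq_single i, Finset.sum_eq_single j]
  · simp
  · intro k _ hk; simp [hk]
  · simp
  · intro k _ hk; simp [hk]
  · simp

/-- A `ℤ/2`-graded associative algebra with its super commutator is a Lie superalgebra. -/
noncomputable def ofGradedAlgebra {K A : Type*} [Field K] [Ring A] [Algebra K A]
    (𝒜 : ZMod 2 → Submodule K A) [GradedAlgebra 𝒜] : LieSuperalgebra K A where
  grading := 𝒜
  isCompl := by
    refine (DirectSum.isInternal_submodule_iff_isCompl 𝒜 (i := 0) (j := 1) (by decide) ?_).1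
      (DirectSum.Decomposition.isInternal 𝒜)
    have h2 : ∀ a : ZMod 2, a = 0 ∨ a = 1 := by decide
    exact (Set.eq_univ_of_forall fun k => h2 k).symm
  bracket := superCommutator 𝒜
  bracket_mem := by
    intro i j x y hx hy
    rw [superCommutator_apply 𝒜 hx hy]
    exact sub_mem (SetLike.mul_mem_graded hx hy)
      (Submodule.smul_mem _ _ (add_comm j i ▸ SetLike.mul_mem_graded hy hx))
  bracket_skew := by
    intro i j x y hx hy
    rw [superCommutator_apply 𝒜 hx hy, superCommutator_apply 𝒜 hy hx, mul_comm j.val i.val,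
      smul_sub, smul_smul, ← mul_pow]
    simp
  jacobi := by
    intro i j x y z hx hy
    induction z using DirectSum.Decomposition.inductionOn 𝒜 with
    | zero => simp
    | add a b ha hb =>
      simp only [map_add, smul_add, ha, hb]
      abel
    | @homogeneous k z =>
      obtain ⟨z, hz⟩ := z
      have hm : ∀ {a b : ZMod 2} {u v : A}, u ∈ 𝒜 a → v ∈ 𝒜 b →
          u * v - (-1 : K) ^ (a.val * b.val) • (v * u) ∈ 𝒜 (a + b) := fun {a b u v} hu hv =>
        sub_mem (SetLike.mul_mem_graded hu hv)
          (Submodule.smul_mem _ _ (add_comm b a ▸ SetLike.mul_mem_graded hv hu))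
      simp only []
      rw [superCommutator_apply 𝒜 hy hz, superCommutator_apply 𝒜 hx hy,
        superCommutator_apply 𝒜 hx hz, superCommutator_apply 𝒜 hx (hm hy hz),
        superCommutator_apply 𝒜 (hm hx hy) hz, superCommutator_apply 𝒜 hy (hm hx hz)]
      have hv : (0 : ZMod 2).val = 0 ∧ (1 : ZMod 2).val = 1 ∧ (1 + 1 : ZMod 2) = 0 := by decide
      have h2 : ∀ a : ZMod 2, a = 0 ∨ a = 1 := by decide
      obtain ⟨hv0, hv1, h11⟩ := hv
      rcases h2 i with rfl | rfl <;> rcases h2 j with rfl | rfl <;> rcases h2 k with rfl | rfl <;>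
        simp only [hv0, hv1, h11, add_zero, zero_add, mul_zero, mul_one, pow_zero,
          pow_one, one_smul, neg_smul] <;> noncomm_ring

end LieSuperalgebra

/-- The defining relations of the Weyl algebra in the free algebra on the `2 n` generators
`p i` (the generator `Sum.inl i`) and `q i` (the generator `Sum.inr i`):
`p i q j - q j p i = δ i j`, `p i p j = p j p i`, `q i q j = q j q i`. -/
inductive WeylAlgebra.Rel (K : Type*) [Field K] (n : ℕ) :
    FreeAlgebra K (Fin n ⊕ Fin n) → FreeAlgebra K (Fin n ⊕ Fin n) → Prop
  | pq (i j : Fin n) : WeylAlgebra.Rel K n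
      (FreeAlgebra.ι K (Sum.inl i) * FreeAlgebra.ι K (Sum.inr j) -
        FreeAlgebra.ι K (Sum.inr j) * FreeAlgebra.ι K (Sum.inl i)) (if i = j then 1 else 0)
  | pp (i j : Fin n) : WeylAlgebra.Rel K n
      (FreeAlgebra.ι K (Sum.inl i) * FreeAlgebra.ι K (Sum.inl j) -
        FreeAlgebra.ι K (Sum.inl j) * FreeAlgebra.ι K (Sum.inl i)) 0
  | qq (i j : Fin n) : WeylAlgebra.Rel K n
      (FreeAlgebra.ι K (Sum.inr i) * FreeAlgebra.ι K (Sum.inr j) -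
        FreeAlgebra.ι K (Sum.inr j) * FreeAlgebra.ι K (Sum.inr i)) 0

/-- The Weyl algebra `W(n)` over `K`, by generators and relations. -/
def WeylAlgebra (K : Type*) [Field K] (n : ℕ) : Type _ := RingQuot (WeylAlgebra.Rel K n)

namespace WeylAlgebra

section

variable (K : Type*) [Field K] (n : ℕ)

noncomputable instance : Ring (WeylAlgebra K n) :=
  inferInstanceAs (Ring (RingQuot (WeylAlgebra.Rel K n)))

noncomputable instance : Algebra K (WeylAlgebra K n) :=
  inferInstanceAs (Algebra K (RingQuot (WeylAlgebra.Rel K n)))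

/-- The generators of the Weyl algebra: `gen K n (Sum.inl i)` is `p i` and `gen K n (Sum.inr i)`
is `q i`. -/
noncomputable def gen (a : Fin n ⊕ Fin n) : WeylAlgebra K n :=
  RingQuot.mkAlgHom K (WeylAlgebra.Rel K n) (FreeAlgebra.ι K a)

variable {K n}

lemma gen_pq (i j : Fin n) : gen K n (Sum.inl i) * gen K n (Sum.inr j) -
    gen K n (Sum.inr j) * gen K n (Sum.inl i) = if i = j then 1 else 0 := by
  have h := RingQuot.mkAlgHom_rel K (Rel.pq (K := K) (n := n) i j)
  simp only [map_sub, map_mul] at h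
  refine h.trans ?_
  split_ifs
  · exact map_one _
  · exact map_zero _

lemma gen_pp (i j : Fin n) : gen K n (Sum.inl i) * gen K n (Sum.inl j) -
    gen K n (Sum.inl j) * gen K n (Sum.inl i) = 0 := by
  have h := RingQuot.mkAlgHom_rel K (Rel.pp (K := K) (n := n) i j)
  simp only [map_sub, map_mul] at h
  exact h.trans (map_zero _)

lemma gen_qq (i j : Fin n) : gen K n (Sum.inr i) * gen K n (Sum.inr j) -
    gen K n (Sum.inr j) * gen K n (Sum.inr i) = 0 := by
  have h := RingQuot.mkAlgHom_rel K (Rel.qq (K := K) (n := n) i j)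
  simp only [map_sub, map_mul] at h
  exact h.trans (map_zero _)

/-- The universal property of the Weyl algebra. -/
noncomputable def lift {B : Type*} [Ring B] [Algebra K B] (f : Fin n ⊕ Fin n → B)
    (hpq : ∀ i j, f (Sum.inl i) * f (Sum.inr j) - f (Sum.inr j) * f (Sum.inl i) =
      if i = j then 1 else 0)
    (hpp : ∀ i j, f (Sum.inl i) * f (Sum.inl j) - f (Sum.inl j) * f (Sum.inl i) = 0)
    (hqq : ∀ i j, f (Sum.inr i) * f (Sum.inr j) - f (Sum.inr j) * f (Sum.inr i) = 0) :
    WeylAlgebra K n →ₐ[K] B :=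
  RingQuot.liftAlgHom K ⟨FreeAlgebra.lift K f, by
    intro x y h
    induction h with
    | pq i j =>
      simp only [map_sub, map_mul, FreeAlgebra.lift_ι_apply, hpq]
      split_ifs <;> simp
    | pp i j => simp [hpp]
    | qq i j => simp [hqq]⟩

lemma lift_gen {B : Type*} [Ring B] [Algebra K B] (f : Fin n ⊕ Fin n → B) (hpq hpp hqq)
    (a : Fin n ⊕ Fin n) : lift (K := K) f hpq hpp hqq (gen K n a) = f a := by
  unfold lift gen
  erw [RingQuot.liftAlgHom_mkAlgHom_apply]
  simp

lemma hom_ext {B : Type*} [Ring B] [Algebra K B] {f g : WeylAlgebra K n →ₐ[K] B}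
    (h : ∀ a, f (gen K n a) = g (gen K n a)) : f = g := by
  refine RingQuot.ringQuot_ext' (S := K) (s := Rel K n) f g (FreeAlgebra.hom_ext (funext fun a => ?_))
  exact h a

variable (K n)

/-- The `ℤ/2`-grading of the Weyl algebra for which all generators are odd: the part of parity `i`
is spanned by the products of generators whose number of factors has parity `i`. -/
noncomputable def parity (i : ZMod 2) : Submodule K (WeylAlgebra K n) :=
  Submodule.span K {x | ∃ l : List (Fin n ⊕ Fin n),
    (l.length : ZMod 2) = i ∧ (l.map (gen K n)).prod = x}

variable {K n}

lemma prod_mem_parity (l : List (Fin n ⊕ Fin n)) :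
    (l.map (gen K n)).prod ∈ parity K n (l.length : ZMod 2) :=
  Submodule.subset_span ⟨l, rfl, rfl⟩

lemma gen_mem_parity (a : Fin n ⊕ Fin n) : gen K n a ∈ parity K n 1 := by
  simpa using prod_mem_parity (K := K) [a]

noncomputable instance : SetLike.GradedMonoid (parity K n) where
  one_mem := by simpa using prod_mem_parity (K := K) (n := n) []
  mul_mem i j x y hx hy := by
    have h : parity K n i * parity K n j ≤ parity K n (i + j) := by
      unfold parity
      rw [Submodule.span_mul_span, Submodule.span_le]
      rintro _ ⟨_, ⟨l, rfl, rfl⟩, _, ⟨m, rfl, rfl⟩, rfl⟩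
      exact Submodule.subset_span ⟨l ++ m, by simp, by simp⟩
    exact h (Submodule.mul_mem_mul hx hy)

/-- The algebra homomorphism from the Weyl algebra to the direct sum of its two parts. -/
noncomputable def toDirectSum : WeylAlgebra K n →ₐ[K] ⨁ i, parity K n i :=
  have key : ∀ (a b : Fin n ⊕ Fin n) (c : WeylAlgebra K n) (hc : c ∈ parity K n 0),
      gen K n a * gen K n b - gen K n b * gen K n a = c →
      DirectSum.of (fun i => parity K n i) 1 ⟨gen K n a, gen_mem_parity a⟩ *
        DirectSum.of (fun i => parity K n i) 1 ⟨gen K n b, gen_mem_parity b⟩ -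
      DirectSum.of (fun i => parity K n i) 1 ⟨gen K n b, gen_mem_parity b⟩ *
        DirectSum.of (fun i => parity K n i) 1 ⟨gen K n a, gen_mem_parity a⟩ =
      DirectSum.of (fun i => parity K n i) 0 ⟨c, hc⟩ := by
    intro a b c hc h
    rw [DirectSum.of_mul_of, DirectSum.of_mul_of]
    refine (map_sub (DirectSum.of (fun i => parity K n i) (1 + 1)) _ _).symm.trans ?_
    refine DirectSum.of_eq_of_gradedMonoid_eq (Sigma.subtype_ext (show (1 + 1 : ZMod 2) = 0 from rfl) ?_)
    exact h
  lift (fun a => DirectSum.of (fun i => parity K n i) 1 ⟨gen K n a, gen_mem_parity a⟩)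
    (fun i j => by
      refine (key _ _ (if i = j then 1 else 0) ?_ (gen_pq i j)).trans ?_
      · split_ifs
        · exact SetLike.GradedOne.one_mem
        · exact zero_mem _
      · split_ifs
        · rfl
        · exact map_zero _)
    (fun i j => (key _ _ 0 (zero_mem _) (gen_pp i j)).trans (map_zero _))
    (fun i j => (key _ _ 0 (zero_mem _) (gen_qq i j)).trans (map_zero _))

lemma toDirectSum_prod (l : List (Fin n ⊕ Fin n)) :
    toDirectSum (l.map (gen K n)).prod =
      DirectSum.of (fun i => parity K n i) (l.length : ZMod 2) ⟨_, prod_mem_parity l⟩ := by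
  induction l with
  | nil =>
    refine (map_one _).trans (DirectSum.of_eq_of_gradedMonoid_eq (Sigma.subtype_ext ?_ rfl))
    exact Nat.cast_zero.symm
  | cons a l ih =>
    have h : toDirectSum (gen K n a) =
        DirectSum.of (fun i => parity K n i) 1 ⟨gen K n a, gen_mem_parity a⟩ :=
      lift_gen _ _ _ _ a
    have e : ((a :: l).map (gen K n)).prod = gen K n a * (l.map (gen K n)).prod := by simp
    conv_lhs => rw [e, map_mul, ih, h, DirectSum.of_mul_of]
    refine DirectSum.of_eq_of_gradedMonoid_eq (Sigma.subtype_ext ?_ e.symm)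
    exact (add_comm _ _).trans (Nat.cast_succ l.length).symm

noncomputable instance : GradedAlgebra (parity K n) :=
  GradedAlgebra.ofAlgHom (parity K n) toDirectSum
    (hom_ext fun a => by
      have h : toDirectSum (gen K n a) =
          DirectSum.of (fun i => parity K n i) 1 ⟨gen K n a, gen_mem_parity a⟩ :=
        lift_gen _ _ _ _ a
      simp [h])
    (fun i x => by
      obtain ⟨x, hx⟩ := x
      induction hx using Submodule.span_induction with
      | mem x h =>
        obtain ⟨l, rfl, rfl⟩ := h
        exact toDirectSum_prod l
      | zero => exact (map_zero _).trans (map_zero _).symm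
      | add x y hx hy h h' =>
        exact (map_add _ _ _).trans ((congrArg₂ (· + ·) h h').trans (map_add _ _ _).symm)
      | smul c x hx h =>
        refine (map_smul toDirectSum c x).trans ((congrArg (c • ·) h).trans ?_)
        exact (map_smul (DirectSum.lof K _ (fun i => parity K n i) i) c ⟨x, hx⟩).symm)

variable (K n)

/-- The Weyl algebra as a Lie superalgebra, `[F, G] = F G - (-1)^{|F||G|} G F`. -/
noncomputable def lieSuperalgebra : LieSuperalgebra K (WeylAlgebra K n) :=
  LieSuperalgebra.ofGradedAlgebra (parity K n)

end

end WeylAlgebra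

/-!
The Weyl algebra `W` is identified with the polynomial ring in the `2 n` variables `p i`, `q i` by
taking Weyl symbols. Left and right multiplication by a generator become multiplication by the
variable `X a` plus, respectively minus, half of the Hamiltonian derivation `hamDeriv a`
(`symbol_gen_mul`, `symbol_mul_gen`). The symbol map is injective because symmetrisation is a left
inverse of it (`jordanRep_symbol`).

The constant term of the symbol is a supertrace (`supertrace_mul_comm`): the two multiplications by
a generator differ in the sign of the derivation, and only this part contributes to the constant
term. The form `supertrace (x * y)` is therefore even, supersymmetric and invariant. The symbols
of its radical form a space that is stable under all derivatives and contains no constant terms, so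
it is zero (`eq_zero_of_supertrace_mul_eq_zero`).

The heart of the proof is `mem_of_supertrace_eq_zero`: the kernel of the supertrace, that is, the
space of polynomials without constant term, has no proper nonzero subspace `N` stable under the
adjoint action of `[W, W]`. The quadratic elements of `[W, W]` act as the symplectic Lie algebra.
A highest weight argument yields a power `X c ^ d` in `N` (`exists_X_pow_mem`), and with it come all
monomials of degree `d` (`monomial_mem_of_X_pow_mem`). The degree is changed by brackets with powers
of the generators (`mem_of_constantCoeff_eq_zero`). No homogeneity of `N` is needed. Applied to
`[W, W]` itself, the result shows that `[W, W]` is the kernel of the supertrace, which is the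
orthogonal complement of `1`, so that the form restricts to a nondegenerate one. Applied to ideals
of `[W, W]`, it gives simplicity.
-/

/-! ### Derivatives of polynomials -/

namespace MvPolynomial

variable {K σ : Type*} [Field K]

/-- Iterating a partial derivative eventually kills a polynomial. -/
lemma exists_iterate_pderiv_eq_zero (i : σ) (f : MvPolynomial σ K) :
    ∃ k, (pderiv (R := K) i)^[k] f = 0 := by
  classical
  suffices h : ∀ (k : ℕ) (f : MvPolynomial σ K), (∀ m, k ≤ m i → coeff m f = 0) →
      (pderiv (R := K) i)^[k] f = 0 by
    refine ⟨f.degreeOf i + 1, h _ f fun m hm => ?_⟩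
    by_contra hc
    exact absurd (monomial_le_degreeOf i (mem_support_iff.2 hc)) (by omega)
  intro k
  induction k with
  | zero => intro f hf; ext m; simp [hf m]
  | succ k ih =>
    intro f hf
    rw [Function.iterate_succ_apply]
    refine ih _ fun m hm => ?_
    rw [coeff_pderiv, hf _ (by simpa using hm), zero_mul]

variable [CharZero K]

/-- A subspace of polynomials that is stable under all partial derivatives and consists of
polynomials without constant term is zero: the coefficients of a polynomial are, up to factorials,
the constant terms of its iterated derivatives. -/
lemma eq_zero_of_pderiv_mem {N : Submodule K (MvPolynomial σ K)}
    (hN : ∀ i, ∀ f ∈ N, pderiv i f ∈ N) (h0 : ∀ f ∈ N, constantCoeff f = 0)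
    {f : MvPolynomial σ K} (hf : f ∈ N) : f = 0 := by
  classical
  have key : ∀ (d : ℕ) (m : σ →₀ ℕ), m.degree = d → ∀ f ∈ N, coeff m f = 0 := by
    intro d
    induction d with
    | zero =>
      intro m hm f hf
      rw [(Finsupp.degree_eq_zero_iff m).1 hm]
      exact h0 f hf
    | succ d ih =>
      intro m hm f hf
      obtain ⟨i, hi⟩ : ∃ i, m i ≠ 0 := by
        by_contra! h
        have : m = 0 := Finsupp.ext h
        simp [this] at hm
      obtain ⟨m', rfl⟩ : ∃ m', m = m' + Finsupp.single i 1 :=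
        ⟨m - Finsupp.single i 1, by
          rw [tsub_add_cancel_of_le]; simpa [Nat.one_le_iff_ne_zero] using hi⟩
      have := ih m' (by simpa using hm) _ (hN i f hf)
      rw [coeff_pderiv] at this
      have h1 : ((m' i : K) + 1) ≠ 0 := Nat.cast_add_one_ne_zero _
      exact (mul_eq_zero.1 this).resolve_right h1
  ext m
  simp [key _ m rfl f hf]

lemma eq_C_of_pderiv_eq_zero {f : MvPolynomial σ K} (hf : ∀ i, pderiv i f = 0) :
    f = C (constantCoeff f) := by
  rw [← sub_eq_zero]
  refine eq_zero_of_pderiv_mem (N := K ∙ (f - C (constantCoeff f))) ?_ ?_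
    (Submodule.mem_span_singleton_self _)
  · intro i g hg
    obtain ⟨a, rfl⟩ := Submodule.mem_span_singleton.1 hg
    simp [hf]
  · intro g hg
    obtain ⟨a, rfl⟩ := Submodule.mem_span_singleton.1 hg
    simp [constantCoeff_smul]

end MvPolynomial

namespace WeylAlgebra

open MvPolynomial

section Polynomials

variable {K : Type*} [Field K] {n : ℕ}

/-- The sign `1` for the index of a generator `p i` and `-1` for the index of a generator `q i`. -/
def sgn (K : Type*) [Field K] {n : ℕ} : Fin n ⊕ Fin n → K := Sum.elim (fun _ => 1) fun _ => -1

lemma sgn_mul_self (a : Fin n ⊕ Fin n) : sgn K a * sgn K a = 1 := by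
  cases a <;> simp [sgn]

lemma sgn_ne_zero (a : Fin n ⊕ Fin n) : sgn K a ≠ 0 :=
  left_ne_zero_of_mul_eq_one (sgn_mul_self a)

lemma sgn_swap (a : Fin n ⊕ Fin n) : sgn K a.swap = -sgn K a := by
  cases a <;> simp [sgn]

lemma swap_ne (a : Fin n ⊕ Fin n) : a.swap ≠ a := by cases a <;> simp

/-- The Hamiltonian derivation of the polynomial ring in the `2 n` variables `p i`, `q i`
attached to a variable: `∂/∂(q i)` for `p i` and `-∂/∂(p i)` for `q i`. -/
noncomputable def hamDeriv (a : Fin n ⊕ Fin n) :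
    Derivation K (MvPolynomial (Fin n ⊕ Fin n) K) (MvPolynomial (Fin n ⊕ Fin n) K) :=
  sgn K a • pderiv a.swap

local notation "S" => MvPolynomial (Fin n ⊕ Fin n) K

lemma hamDeriv_apply (a : Fin n ⊕ Fin n) (f : S) :
    hamDeriv a f = sgn K a • pderiv a.swap f := rfl

lemma pderiv_eq_hamDeriv (a : Fin n ⊕ Fin n) (f : S) :
    pderiv a f = -(sgn K a • hamDeriv a.swap f) := by
  rw [hamDeriv_apply, sgn_swap, Sum.swap_swap, smul_smul, mul_neg, sgn_mul_self, neg_smul,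
    one_smul, neg_neg]

lemma hamDeriv_X (a b : Fin n ⊕ Fin n) :
    hamDeriv a (X b : S) = if b = a.swap then C (sgn K a) else 0 := by
  classical
  rw [hamDeriv_apply, pderiv_X, Pi.single_apply]
  split_ifs
  · rw [smul_eq_C_mul, mul_one]
  · simp

lemma hamDeriv_X_mul (a b : Fin n ⊕ Fin n) (f : S) :
    hamDeriv a (X b * f) = X b * hamDeriv a f + if b = a.swap then sgn K a • f else 0 := by
  rw [Derivation.leibniz, hamDeriv_X, smul_eq_mul, smul_eq_mul]
  split_ifs
  · rw [smul_eq_C_mul, mul_comm f]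
  · simp

lemma hamDeriv_comm (a b : Fin n ⊕ Fin n) (f : S) :
    hamDeriv a (hamDeriv b f) = hamDeriv b (hamDeriv a f) := by
  rw [← sub_eq_zero]
  change ⁅hamDeriv (K := K) a, hamDeriv b⁆ f = 0
  suffices h : ⁅hamDeriv a, hamDeriv b⁆ = (0 : Derivation K S S) by rw [h]; rfl
  refine MvPolynomial.derivation_ext fun c => ?_
  rw [Derivation.commutator_apply, hamDeriv_X, hamDeriv_X]
  split_ifs <;> simp

lemma hamDeriv_monomial (a : Fin n ⊕ Fin n) (m : Fin n ⊕ Fin n →₀ ℕ) :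
    hamDeriv a (monomial m (1 : K)) =
      (sgn K a * m a.swap) • monomial (m - Finsupp.single a.swap 1) 1 := by
  rw [hamDeriv_apply, pderiv_monomial, one_mul, smul_monomial, smul_monomial]
  simp

lemma X_mul_monomial (a : Fin n ⊕ Fin n) (m : Fin n ⊕ Fin n →₀ ℕ) :
    X a * monomial m (1 : K) = monomial (m + Finsupp.single a 1) 1 := by
  rw [X, monomial_mul, one_mul, add_comm]

lemma hamDeriv_X_pow (a b : Fin n ⊕ Fin n) (k : ℕ) :
    hamDeriv a (X b ^ k : S) = if b = a.swap then (sgn K a * k) • X b ^ (k - 1) else 0 := by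
  rw [Derivation.leibniz_pow, hamDeriv_X]
  split_ifs
  · rw [smul_eq_mul, mul_comm, ← smul_eq_C_mul, mul_smul, Nat.cast_smul_eq_nsmul,
      smul_comm]
  · simp

lemma exists_iterate_hamDeriv_eq_zero (a : Fin n ⊕ Fin n) (f : S) :
    ∃ k, (hamDeriv (K := K) a)^[k] f = 0 := by
  obtain ⟨k, hk⟩ := exists_iterate_pderiv_eq_zero a.swap f
  refine ⟨k, ?_⟩
  have h : ∀ k, (hamDeriv (K := K) a)^[k] f = sgn K a ^ k • (pderiv (R := K) a.swap)^[k] f := by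
    intro k
    induction k with
    | zero => simp
    | succ k ih =>
      rw [Function.iterate_succ_apply', Function.iterate_succ_apply', ih, Derivation.map_smul,
        hamDeriv_apply, smul_smul, pow_succ]
  rw [h, hk, smul_zero]

variable [CharZero K]

lemma eq_C_of_hamDeriv_eq_zero {f : S} (hf : ∀ a, hamDeriv a f = 0) :
    f = C (constantCoeff f) :=
  eq_C_of_pderiv_eq_zero fun a => by rw [pderiv_eq_hamDeriv, hf, smul_zero, neg_zero]

end Polynomials

end WeylAlgebra

/-! ### Irreducibility of the polynomials without constant term -/

namespace WeylAlgebra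

open MvPolynomial

section Irreducibility

variable {K : Type*} [Field K] {n : ℕ}

local notation "S" => MvPolynomial (Fin n ⊕ Fin n) K

lemma weight_add_le_of_coeff_X_mul_hamDeriv_ne_zero (w : Fin n ⊕ Fin n → ℕ) {k : ℕ} {f : S}
    (hf : ∀ m, coeff m f ≠ 0 → Finsupp.weight w m ≤ k) (a b : Fin n ⊕ Fin n)
    {m : Fin n ⊕ Fin n →₀ ℕ} (hm : coeff m (X b * hamDeriv a f) ≠ 0) :
    Finsupp.weight w m + w a.swap ≤ k + w b := by
  classical
  rw [coeff_X_mul'] at hm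
  split_ifs at hm with hb
  · obtain ⟨m', rfl⟩ : ∃ m', m = m' + Finsupp.single b 1 :=
      ⟨m - Finsupp.single b 1, by
        rw [tsub_add_cancel_of_le]; simpa [Nat.one_le_iff_ne_zero] using hb⟩
    rw [add_tsub_cancel_right, hamDeriv_apply, coeff_smul, coeff_pderiv] at hm
    have := hf (m' + Finsupp.single a.swap 1) fun h => hm (by rw [h]; simp)
    simp only [map_add, Finsupp.weight_single, one_smul] at this ⊢
    omega
  · exact absurd rfl hm

variable [CharZero K]

/-- For the weights `0` for `c`, `2` for its dual variable and `1` for all others, the operators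
`X c * hamDeriv a + X a * hamDeriv c` with `a` not dual to `c` lower the weight. A nonzero element
of least weight is hence killed by all of them, and so by all `hamDeriv a`. -/
lemma exists_hamDeriv_eq_zero {N : Submodule K S}
    (hQ : ∀ a b, ∀ f ∈ N, X a * hamDeriv b f + X b * hamDeriv a f ∈ N) (hN : N ≠ ⊥)
    (c : Fin n ⊕ Fin n) : ∃ f ∈ N, f ≠ 0 ∧ ∀ a, a ≠ c.swap → hamDeriv a f = 0 := by
  classical
  set w : Fin n ⊕ Fin n → ℕ := fun a => if a = c then 0 else if a = c.swap then 2 else 1 with hw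
  have hw2 : ∀ a, w a + w a.swap = 2 := by
    intro a
    have h1 : a.swap = c ↔ a = c.swap := by
      constructor <;> rintro rfl <;> simp
    have h2 : a.swap = c.swap ↔ a = c := Sum.swap_leftInverse.injective.eq_iff
    have h3 := swap_ne c
    simp only [hw, h1, h2]
    by_cases h : a = c
    · subst h; simp [h3.symm]
    · by_cases h' : a = c.swap
      · subst h'; simp [h3]
      · simp [h, h']
  have key : ∀ k : ℕ, ∀ f ∈ N, f ≠ 0 → (∀ m, coeff m f ≠ 0 → Finsupp.weight w m < k) →
      ∃ f ∈ N, f ≠ 0 ∧ ∀ a, a ≠ c.swap → hamDeriv a f = 0 := by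
    intro k
    induction k with
    | zero =>
      intro f _ hf0 hk
      obtain ⟨m, hm⟩ := MvPolynomial.ne_zero_iff.1 hf0
      exact absurd (hk m hm) (Nat.not_lt_zero _)
    | succ k ih =>
      intro f hf hf0 hk
      by_cases hall : ∀ a, a ≠ c.swap → X c * hamDeriv a f + X a * hamDeriv c f = 0
      · refine ⟨f, hf, hf0, ?_⟩
        have hc : hamDeriv c f = 0 := by
          have := hall c (swap_ne c).symm
          rw [← two_mul] at this
          simpa [X_ne_zero] using this
        intro a ha
        have := hall a ha
        rw [hc] at this
        simpa [X_ne_zero] using this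
      · push Not at hall
        obtain ⟨a, ha, hne⟩ := hall
        refine ih _ (hQ c a f hf) hne fun m hm => ?_
        have hk' := fun m hm => Nat.le_of_lt_succ (hk m hm)
        have ha1 : w a ≤ 1 := by simp only [hw, if_neg ha]; split_ifs <;> omega
        have hwa := hw2 a
        have hwc := hw2 c
        have hwc0 : w c = 0 := by simp [hw]
        rw [coeff_add] at hm
        by_cases h1 : coeff m (X c * hamDeriv a f) = 0
        · rw [h1, zero_add] at hm
          have := weight_add_le_of_coeff_X_mul_hamDeriv_ne_zero w hk' c a hm
          omega
        · have := weight_add_le_of_coeff_X_mul_hamDeriv_ne_zero w hk' a c h1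
          omega
  obtain ⟨f, hf, hf0⟩ := N.exists_mem_ne_zero_of_ne_bot hN
  refine key (weightedTotalDegree w f + 1) f hf hf0 fun m hm => Nat.lt_succ_of_le ?_
  exact le_weightedTotalDegree w (mem_support_iff.2 hm)

/-- Since `hamDeriv c` kills `X c`, the powers of `X c * hamDeriv c` are
`X c ^ k * hamDeriv c ^ k`. -/
lemma X_pow_mul_iterate_hamDeriv_mem {N : Submodule K S}
    (hQ : ∀ a b, ∀ f ∈ N, X a * hamDeriv b f + X b * hamDeriv a f ∈ N) (c : Fin n ⊕ Fin n)
    {f : S} (hf : f ∈ N) (k : ℕ) : X c ^ k * (hamDeriv c)^[k] f ∈ N := by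
  induction k with
  | zero => simpa using hf
  | succ k ih =>
    have h := hQ c c _ ih
    rw [← two_smul K, Derivation.leibniz, hamDeriv_X_pow, if_neg (swap_ne c).symm, smul_zero,
      add_zero, smul_eq_mul, ← mul_assoc (X c), ← pow_succ',
      ← Function.iterate_succ_apply' (hamDeriv c)] at h
    exact (Submodule.smul_mem_iff _ two_ne_zero).1 h

/-- A polynomial killed by all `hamDeriv a` with `a ≠ c` depends only on the variable dual to `c`,
and the operator `X c * hamDeriv c` turns it, after `d` steps, where `d` is its degree,
into a multiple of `X c ^ d`. -/
lemma exists_X_pow_mem {N : Submodule K S}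
    (hQ : ∀ a b, ∀ f ∈ N, X a * hamDeriv b f + X b * hamDeriv a f ∈ N)
    (h0 : ∀ f ∈ N, constantCoeff f = 0) (hN : N ≠ ⊥) (c : Fin n ⊕ Fin n) :
    ∃ d, d ≠ 0 ∧ X c ^ d ∈ N := by
  classical
  obtain ⟨f, hf, hf0, hd⟩ := exists_hamDeriv_eq_zero hQ hN c.swap
  rw [Sum.swap_swap] at hd
  have hex := exists_iterate_hamDeriv_eq_zero c f
  obtain ⟨d, hd1⟩ : ∃ d, Nat.find hex = d + 1 := by
    refine Nat.exists_eq_succ_of_ne_zero fun h => hf0 ?_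
    simpa [h] using Nat.find_spec hex
  have hne : (hamDeriv c)^[d] f ≠ 0 := Nat.find_min hex (by omega)
  have hz : (hamDeriv c)^[d + 1] f = 0 := hd1 ▸ Nat.find_spec hex
  have hC := eq_C_of_hamDeriv_eq_zero (f := (hamDeriv c)^[d] f) fun a => by
    by_cases ha : a = c
    · rw [ha, ← Function.iterate_succ_apply' (hamDeriv c), hz]
    · have : ∀ k, hamDeriv a ((hamDeriv c)^[k] f) = 0 := by
        intro k
        induction k with
        | zero => exact hd a ha
        | succ k ih => rw [Function.iterate_succ_apply', hamDeriv_comm, ih, map_zero]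
      exact this d
  have hmem := X_pow_mul_iterate_hamDeriv_mem hQ c hf d
  refine ⟨d, ?_, ?_⟩
  · rintro rfl
    have h := h0 f hf
    simp only [Function.iterate_zero, id] at hC hne
    rw [h, map_zero] at hC
    exact hne hC
  · rw [hC, mul_comm, ← smul_eq_C_mul] at hmem
    refine (Submodule.smul_mem_iff _ fun h => ?_).1 hmem
    rw [h, map_zero] at hC
    exact hne hC

/-- The operators `X a * hamDeriv b + X b * hamDeriv a` generate all monomials of degree `d` from
`X c ^ d`: this is the irreducibility of the symmetric powers of the standard representation of
the symplectic Lie algebra. The induction is on the weight of the monomial, where `c` has weight `0`,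
its dual variable weight `1` and every other variable weight `2`. -/
lemma monomial_mem_of_X_pow_mem {N : Submodule K S}
    (hQ : ∀ a b, ∀ f ∈ N, X a * hamDeriv b f + X b * hamDeriv a f ∈ N) {c : Fin n ⊕ Fin n}
    {d : ℕ} (hc : X c ^ d ∈ N) {m : Fin n ⊕ Fin n →₀ ℕ} (hm : m.degree = d) :
    monomial m 1 ∈ N := by
  classical
  set w : Fin n ⊕ Fin n → ℕ := fun a => if a = c then 0 else if a = c.swap then 1 else 2 with hw
  have hwc : w c = 0 := by simp [hw]
  have hwc' : w c.swap = 1 := by simp [hw, swap_ne]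
  induction hk : Finsupp.weight w m using Nat.strong_induction_on generalizing m with
  | _ k ih =>
  subst hk
  by_cases h : ∃ b, b ≠ c ∧ m b ≠ 0
  · obtain ⟨b, hbc, hb⟩ := h
    obtain ⟨m', rfl⟩ : ∃ m', m = m' + Finsupp.single b 1 :=
      ⟨m - Finsupp.single b 1, by
        rw [tsub_add_cancel_of_le]; simpa [Nat.one_le_iff_ne_zero] using hb⟩
    have hwb : 0 < w b := by simp only [hw, if_neg hbc]; split_ifs <;> omega
    simp only [map_add, Finsupp.weight_single, one_smul, Finsupp.degree_single] at ih hm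
    have hmem : monomial (m' + Finsupp.single c 1) (1 : K) ∈ N := by
      refine ih _ ?_ ?_ rfl
      · simp [Finsupp.weight_single, hwc, hwb]
      · simp [hm]
    have hq := hQ b c.swap _ hmem
    have hmain : X b * hamDeriv c.swap (monomial (m' + Finsupp.single c 1) (1 : K)) =
        (sgn K c.swap * (m' c + 1)) • monomial (m' + Finsupp.single b 1) 1 := by
      rw [hamDeriv_monomial, Sum.swap_swap, add_tsub_cancel_right, mul_smul_comm, X_mul_monomial]
      simp
    -- This term vanishes or is a multiple of a monomial with two variables fewer of weight two and
    -- one more of weight one. If `b` is dual to `c`, it is equal to the other term.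
    have hjunk : X c.swap * hamDeriv b (monomial (m' + Finsupp.single c 1) (1 : K)) ∈ N := by
      by_cases hbs : b = c.swap
      · subst hbs
        rw [← two_smul K] at hq
        exact (Submodule.smul_mem_iff _ two_ne_zero).1 hq
      have hbs' : c ≠ b.swap := fun h => hbs (by rw [h, Sum.swap_swap])
      rw [hamDeriv_monomial, mul_smul_comm, X_mul_monomial]
      rw [Finsupp.add_apply, Finsupp.single_eq_of_ne hbs'.symm, add_zero]
      by_cases hb0 : m' b.swap = 0
      · simp [hb0]
      obtain ⟨m, rfl⟩ : ∃ m, m' = m + Finsupp.single b.swap 1 :=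
        ⟨m' - Finsupp.single b.swap 1, by
          rw [tsub_add_cancel_of_le]; simpa [Nat.one_le_iff_ne_zero] using hb0⟩
      have hw2 : w b.swap = 2 := by
        simp only [hw]
        rw [if_neg hbs'.symm, if_neg fun h => hbc (Sum.swap_leftInverse.injective h)]
      rw [add_right_comm, add_tsub_cancel_right]
      refine N.smul_mem _ (ih _ ?_ ?_ rfl)
      · simp only [map_add, Finsupp.weight_single, one_smul, hwc, hwc', hw2]
        omega
      · simp only [map_add, Finsupp.degree_single] at hm ⊢
        omega
    rw [hmain] at hq
    have := (N.add_mem_iff_left hjunk).1 hq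
    refine (Submodule.smul_mem_iff _ ?_).1 this
    exact mul_ne_zero (sgn_ne_zero _) (Nat.cast_add_one_ne_zero _)
  · push Not at h
    have hmc : m = Finsupp.single c (m c) := by
      ext b
      by_cases hb : b = c
      · simp [hb]
      · simp [h b hb, Ne.symm hb]
    rw [hmc, Finsupp.degree_single] at hm
    rw [hmc, hm, ← X_pow_eq_monomial]
    exact hc

/-- Irreducibility of the space of polynomials without constant term. The operators in `hQ` are the
adjoint actions of the elements of degree two and those in `hR` the adjoint actions of the fourth
powers of the generators. The hypotheses `hadd` and `hpred` come from the brackets of powers of a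
generator with its odd powers and with the dual generator. -/
lemma mem_of_constantCoeff_eq_zero {N : Submodule K S}
    (hQ : ∀ a b, ∀ f ∈ N, X a * hamDeriv b f + X b * hamDeriv a f ∈ N)
    (hR : ∀ a, ∀ f ∈ N, (4 : K) • (X a ^ 3 * hamDeriv a f) +
      X a * hamDeriv a (hamDeriv a (hamDeriv a f)) ∈ N)
    (hadd : ∀ c d e, Odd d → Odd e → X c ^ d ∈ N → X c ^ (d + e) ∈ N)
    (hpred : ∀ c d, Odd d → X c ^ (d + 1) ∈ N → X c ^ d ∈ N)
    (h0 : ∀ f ∈ N, constantCoeff f = 0) (hN : N ≠ ⊥) (hn : 1 ≤ n)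
    {f : S} (hf : constantCoeff f = 0) : f ∈ N := by
  classical
  set c : Fin n ⊕ Fin n := Sum.inl ⟨0, hn⟩
  -- Odd exponents can be lowered by two, so that the least one in `N` is `1`.
  have hodd : ∀ k, X c ^ (2 * k + 1) ∈ N → (X c : S) ∈ N := by
    intro k
    induction k with
    | zero => simp
    | succ k ih =>
      intro h
      refine ih ?_
      -- The top term of the action of the fourth power of the dual generator on `X c ^ (2 * k + 3)`
      -- has degree `2 * k + 5`. It already lies in `N`, so the term of degree `2 * k + 1` does, too.
      have hup : X c ^ (2 * k + 5) ∈ N :=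
        hpred c _ ⟨k + 2, by ring⟩ (hadd c _ 3 ⟨k + 1, rfl⟩ ⟨1, rfl⟩ h)
      have hr := hR c.swap _ h
      have htop : X c.swap ^ 3 * X c ^ (2 * k + 2) ∈ N := by
        rw [X_pow_eq_monomial, X_pow_eq_monomial, monomial_mul, one_mul]
        refine monomial_mem_of_X_pow_mem hQ hup ?_
        simp only [map_add, Finsupp.degree_single]
        ring
      have e : 2 * (k + 1) + 1 - 1 = 2 * k + 2 := by omega
      have e' : 2 * k + 2 - 1 = 2 * k + 1 := by omega
      have e'' : 2 * k + 1 - 1 = 2 * k := by omega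
      simp only [hamDeriv_X_pow, Sum.swap_swap, if_true, Derivation.map_smul, mul_smul_comm, e,
        e', e''] at hr
      have hlow := (N.add_mem_iff_right (N.smul_mem _ (N.smul_mem _ htop))).1 hr
      rw [smul_smul, smul_smul, Submodule.smul_mem_iff _ (mul_ne_zero (mul_ne_zero
        (mul_ne_zero (sgn_ne_zero _) (Nat.cast_ne_zero.2 (by omega)))
        (mul_ne_zero (sgn_ne_zero _) (Nat.cast_ne_zero.2 (by omega))))
        (mul_ne_zero (sgn_ne_zero _) (Nat.cast_ne_zero.2 (by omega))))] at hlow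
      have hq := hQ c c _ hlow
      rwa [← two_smul K, Submodule.smul_mem_iff _ two_ne_zero, hamDeriv_X_mul, hamDeriv_X_pow,
        if_neg (swap_ne c).symm, if_pos rfl, mul_zero, zero_add, mul_smul_comm,
        Submodule.smul_mem_iff _ (sgn_ne_zero _), ← pow_succ'] at hq
  have hX : (X c : S) ∈ N := by
    obtain ⟨d, hd, hmem⟩ := exists_X_pow_mem hQ h0 hN c
    rcases Nat.even_or_odd' d with ⟨k, rfl | rfl⟩
    · obtain ⟨k, rfl⟩ := Nat.exists_eq_succ_of_ne_zero (n := k) (by omega)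
      exact hodd k (hpred c _ ⟨k, rfl⟩ hmem)
    · exact hodd k hmem
  have hall : ∀ d, d ≠ 0 → (X c : S) ^ d ∈ N := by
    have hev : ∀ k, (X c : S) ^ (2 * k + 1 + 1) ∈ N := fun k => by
      rw [add_comm]
      exact hadd c 1 _ odd_one ⟨k, rfl⟩ (by simpa using hX)
    intro d hd
    rcases Nat.even_or_odd' d with ⟨k, rfl | rfl⟩
    · obtain ⟨k, rfl⟩ := Nat.exists_eq_succ_of_ne_zero (n := k) (by omega)
      exact hev k
    · exact hpred c _ ⟨k, rfl⟩ (hev k)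
  -- The constant term is the only coefficient that is not covered by `hall`.
  rw [f.as_sum]
  refine N.sum_mem fun m hm => ?_
  rw [← mul_one (coeff m f), ← smul_eq_mul, ← smul_monomial]
  refine N.smul_mem _ (monomial_mem_of_X_pow_mem hQ (hall _ ?_) rfl)
  intro hd
  rw [(Finsupp.degree_eq_zero_iff m).1 hd] at hm
  exact mem_support_iff.1 hm hf

end Irreducibility

end WeylAlgebra

namespace WeylAlgebra

open MvPolynomial

/-! ### Weyl symbols -/

section Symbol

variable {K : Type*} [Field K] {n : ℕ}

local notation "S" => MvPolynomial (Fin n ⊕ Fin n) K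
local notation "W" => WeylAlgebra K n

lemma span_words_eq_top :
    Submodule.span K (Set.range fun l : List (Fin n ⊕ Fin n) => (l.map (gen K n)).prod) = ⊤ := by
  rw [eq_top_iff]
  rintro x -
  obtain ⟨a, ha, b, hb, rfl⟩ := (lieSuperalgebra K n).exists_add x
  have h : ∀ i, parity K n i ≤
      Submodule.span K (Set.range fun l : List (Fin n ⊕ Fin n) => (l.map (gen K n)).prod) :=
    fun i => Submodule.span_mono fun _ ⟨l, _, hl⟩ => ⟨l, hl⟩
  exact add_mem (h 0 ha) (h 1 hb)

lemma induction_left {P : W → Prop} (one : P 1) (gen_mul : ∀ a x, P x → P (gen K n a * x))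
    (add : ∀ x y, P x → P y → P (x + y)) (smul : ∀ (c : K) x, P x → P (c • x)) (x : W) : P x := by
  have hx : x ∈ Submodule.span K
      (Set.range fun l : List (Fin n ⊕ Fin n) => (l.map (gen K n)).prod) := by
    rw [span_words_eq_top]; trivial
  induction hx using Submodule.span_induction with
  | mem x h =>
    obtain ⟨l, rfl⟩ := h
    induction l with
    | nil => simpa using one
    | cons a l ih => simpa using gen_mul a _ ih
  | zero => simpa using smul 0 1 one
  | add x y _ _ hx hy => exact add x y hx hy
  | smul c x _ hx => exact smul c x hx

/-- The commutator `gen a * gen b - gen b * gen a` of two generators, as a scalar. -/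
def omega (K : Type*) [Field K] {n : ℕ} (a b : Fin n ⊕ Fin n) : K :=
  if b = a.swap then sgn K a else 0

lemma gen_mul_gen (a b : Fin n ⊕ Fin n) :
    gen K n a * gen K n b = gen K n b * gen K n a + algebraMap K W (omega K a b) := by
  rw [← sub_eq_iff_eq_add']
  rcases a with i | i <;> rcases b with j | j
  · simpa [omega] using gen_pp i j
  · rw [gen_pq]; simp [omega, sgn, eq_comm, apply_ite (algebraMap K W)]
  · rw [← neg_sub, gen_pq]; by_cases h : j = i <;> simp [omega, sgn, h]
  · simpa [omega] using gen_qq i j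

lemma hamDeriv_X_mul_eq_omega (a b : Fin n ⊕ Fin n) (f : S) :
    hamDeriv a (X b * f) = X b * hamDeriv a f + omega K a b • f := by
  rw [hamDeriv_X_mul, omega]
  split_ifs <;> simp

/-- Multiplication by the variable `X a` plus `t` times the derivation `hamDeriv a`. For `t = 1/2`
and `t = -1/2` these are left and right Moyal multiplication by `X a`. -/
noncomputable def moyal (t : K) (a : Fin n ⊕ Fin n) : Module.End K S :=
  LinearMap.mulLeft K (X a) + t • (hamDeriv (K := K) a).toLinearMap

lemma moyal_apply (t : K) (a : Fin n ⊕ Fin n) (f : S) :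
    moyal t a f = X a * f + t • hamDeriv a f := rfl

/-- For `s = t = 1 / 2` these are the relations of the Weyl algebra. For `s = -t` the operators
commute. -/
lemma moyal_sub_moyal (s t : K) (a b : Fin n ⊕ Fin n) :
    moyal s a * moyal t b - moyal t b * moyal s a =
      ((s + t) * omega K a b) • (1 : Module.End K S) := by
  refine LinearMap.ext fun f => ?_
  have hab : omega K b a = - omega K a b := by
    rcases a with i | i <;> rcases b with j | j <;> simp [omega, sgn, eq_comm] <;>
      split_ifs <;> simp
  simp only [LinearMap.sub_apply, Module.End.mul_apply, moyal_apply, map_add,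
    hamDeriv_X_mul_eq_omega,
    Derivation.map_smul, smul_add, LinearMap.smul_apply, Module.End.one_apply, hab,
    hamDeriv_comm a b, mul_smul_comm]
  rw [mul_left_comm (X a) (X b)]
  module

/-- Half the anticommutator with a generator, as an operator on the Weyl algebra. On symbols it
is multiplication by a variable. -/
noncomputable def jordanMul (a : Fin n ⊕ Fin n) : Module.End K W :=
  (1 / 2 : K) • (LinearMap.mulLeft K (gen K n a) + LinearMap.mulRight K (gen K n a))

lemma jordanMul_apply (a : Fin n ⊕ Fin n) (x : W) :
    jordanMul a x = (1 / 2 : K) • (gen K n a * x + x * gen K n a) := rfl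

variable [CharZero K]

/-- The action of the Weyl algebra on polynomials by left Moyal multiplication. -/
noncomputable def moyalRep : W →ₐ[K] Module.End K S :=
  lift (moyal (1 / 2))
    (fun i j => by
      rw [moyal_sub_moyal, add_halves, one_mul]
      simp [omega, sgn, eq_comm])
    (fun i j => by rw [moyal_sub_moyal]; simp [omega])
    (fun i j => by rw [moyal_sub_moyal]; simp [omega])

lemma moyalRep_gen (a : Fin n ⊕ Fin n) : moyalRep (gen K n a) = moyal (1 / 2) a :=
  lift_gen _ _ _ _ a

/-- The Weyl symbol of an element of the Weyl algebra: the polynomial that it produces from `1` by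
left Moyal multiplication. -/
noncomputable def symbol : W →ₗ[K] S := LinearMap.applyₗ (1 : S) ∘ₗ moyalRep.toLinearMap

lemma symbol_apply (x : W) : symbol x = moyalRep x 1 := rfl

lemma symbol_one : symbol (1 : W) = 1 := by simp [symbol_apply]

lemma symbol_gen_mul (a : Fin n ⊕ Fin n) (x : W) :
    symbol (gen K n a * x) = X a * symbol x + (1 / 2 : K) • hamDeriv a (symbol x) := by
  rw [symbol_apply, map_mul, moyalRep_gen]; rfl

lemma symbol_gen (a : Fin n ⊕ Fin n) : symbol (gen K n a) = X a := by
  rw [← mul_one (gen K n a), symbol_gen_mul, symbol_one]; simp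

/-- Right multiplication by a generator is right Moyal multiplication of the symbol, because
left and right Moyal multiplications commute. -/
lemma symbol_mul_gen (x : W) (a : Fin n ⊕ Fin n) :
    symbol (x * gen K n a) = X a * symbol x - (1 / 2 : K) • hamDeriv a (symbol x) := by
  have h : moyalRep x * moyal (-(1 / 2)) a = moyal (-(1 / 2)) a * moyalRep x := by
    induction x using induction_left with
    | one => simp
    | gen_mul b x ih =>
      have hb := moyal_sub_moyal (n := n) (1 / 2 : K) (-(1 / 2)) b a
      rw [add_neg_cancel, zero_mul, zero_smul, sub_eq_zero] at hb
      rw [map_mul, moyalRep_gen, mul_assoc, ih, ← mul_assoc, hb, mul_assoc]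
    | add x y hx hy => rw [map_add, add_mul, mul_add, hx, hy]
    | smul c x hx => rw [map_smul, smul_mul_assoc, mul_smul_comm, hx]
  have h1 : moyalRep (gen K n a) (1 : S) = moyal (-(1 / 2)) a 1 := by
    rw [moyalRep_gen, moyal_apply, moyal_apply]; simp
  rw [symbol_apply, map_mul, Module.End.mul_apply, h1, ← Module.End.mul_apply, h,
    Module.End.mul_apply, moyal_apply, neg_smul, ← sub_eq_add_neg]; rfl

/-- The commutators of the left and of the right multiplications by two generators are opposite
scalars, which cancel in the commutator of their averages. -/
lemma jordanMul_comm (a b : Fin n ⊕ Fin n) :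
    (jordanMul a * jordanMul b : Module.End K W) = jordanMul b * jordanMul a := by
  refine LinearMap.ext fun x => ?_
  simp only [Module.End.mul_apply, jordanMul_apply, mul_smul_comm, smul_mul_assoc, mul_add, add_mul]
  have h1 : gen K n a * (gen K n b * x) = gen K n b * (gen K n a * x) + omega K a b • x := by
    rw [← mul_assoc, gen_mul_gen, add_mul, mul_assoc, Algebra.smul_def]
  have h2 : x * gen K n a * gen K n b = x * gen K n b * gen K n a + omega K a b • x := by
    rw [mul_assoc, gen_mul_gen, mul_add, ← mul_assoc, Algebra.smul_def, Algebra.commutes]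
  rw [h1, h2, mul_assoc (gen K n a), mul_assoc (gen K n b)]
  module

open scoped IsMulCommutative in
/-- The action of polynomials on the Weyl algebra for which a variable acts as half the
anticommutator with the corresponding generator. It is defined through the subalgebra generated by
these operators, which is commutative. -/
noncomputable def jordanRep : S →ₐ[K] Module.End K W :=
  haveI : IsMulCommutative (Algebra.adjoin K (Set.range (jordanMul (K := K) (n := n)))) :=
    Algebra.isMulCommutative_adjoin K (by
      rintro _ ⟨a, rfl⟩ _ ⟨b, rfl⟩
      exact jordanMul_comm a b)
  (Algebra.adjoin K (Set.range (jordanMul (K := K) (n := n)))).val.comp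
    (aeval (S₁ := Algebra.adjoin K (Set.range (jordanMul (K := K) (n := n))))
      fun a => ⟨jordanMul a, Algebra.subset_adjoin ⟨a, rfl⟩⟩)

lemma jordanRep_X (a : Fin n ⊕ Fin n) : jordanRep (X a : S) = jordanMul a := by
  simp [jordanRep]

lemma jordanRep_X_mul (a : Fin n ⊕ Fin n) (f : S) (x : W) :
    jordanRep (X a * f) x =
      (1 / 2 : K) • (gen K n a * jordanRep f x + jordanRep f x * gen K n a) := by
  rw [map_mul, jordanRep_X, Module.End.mul_apply, jordanMul_apply]

lemma gen_mul_jordanRep_sub (a : Fin n ⊕ Fin n) (f : S) :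
    gen K n a * jordanRep f 1 - jordanRep f 1 * gen K n a = jordanRep (hamDeriv a f) 1 := by
  induction f using MvPolynomial.induction_on with
  | C c =>
    rw [← algebraMap_eq, AlgHom.commutes, Derivation.map_algebraMap, map_zero]
    simp
  | add f g hf hg =>
    simp only [map_add, LinearMap.add_apply, mul_add, add_mul, ← hf, ← hg]
    abel
  | mul_X f b ih =>
    rw [mul_comm, hamDeriv_X_mul_eq_omega, map_add, map_smul, LinearMap.add_apply, jordanRep_X_mul,
      jordanRep_X_mul, ← ih, LinearMap.smul_apply]
    generalize (jordanRep f 1 : W) = x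
    have h1 : gen K n a * (gen K n b * x) = gen K n b * (gen K n a * x) + omega K a b • x := by
      rw [← mul_assoc, gen_mul_gen, add_mul, mul_assoc, Algebra.smul_def]
    have h2 : x * gen K n a * gen K n b = x * gen K n b * gen K n a + omega K a b • x := by
      rw [mul_assoc, gen_mul_gen, mul_add, ← mul_assoc, Algebra.smul_def, Algebra.commutes]
    simp only [mul_smul_comm, smul_mul_assoc, mul_add, add_mul, mul_sub, sub_mul, h1, h2]
    simp only [mul_assoc]
    module

lemma gen_mul_jordanRep (a : Fin n ⊕ Fin n) (f : S) :
    gen K n a * jordanRep f 1 = jordanRep (moyal (1 / 2) a f) 1 := by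
  rw [moyal_apply, map_add, map_smul, LinearMap.add_apply, LinearMap.smul_apply, jordanRep_X_mul,
    ← gen_mul_jordanRep_sub]
  module

/-- Symmetrisation `f ↦ jordanRep f 1` is inverse to the symbol map, since it intertwines left Moyal
multiplication with left multiplication. -/
lemma jordanRep_symbol (x : W) : jordanRep (symbol x) 1 = x := by
  induction x using induction_left with
  | one => simp [symbol_one]
  | gen_mul a x ih => rw [symbol_gen_mul, ← moyal_apply, ← gen_mul_jordanRep, ih]
  | add x y hx hy => rw [map_add, map_add, LinearMap.add_apply, hx, hy]
  | smul c x hx => rw [map_smul, map_smul, LinearMap.smul_apply, hx]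

lemma symbol_injective : Function.Injective (symbol : W → S) :=
  Function.LeftInverse.injective (g := fun f => jordanRep f 1) jordanRep_symbol

lemma hamDeriv_symbol (a : Fin n ⊕ Fin n) (x : W) :
    hamDeriv a (symbol x) = symbol (gen K n a * x - x * gen K n a) := by
  rw [map_sub, symbol_gen_mul, symbol_mul_gen]
  module

lemma X_mul_symbol (a : Fin n ⊕ Fin n) (x : W) :
    X a * symbol x = (1 / 2 : K) • symbol (gen K n a * x + x * gen K n a) := by
  rw [map_add, symbol_gen_mul, symbol_mul_gen]
  module

lemma symbol_gen_pow (a : Fin n ⊕ Fin n) (k : ℕ) : symbol (gen K n a ^ k) = X a ^ k := by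
  induction k with
  | zero => simpa using symbol_one
  | succ k ih =>
    rw [pow_succ', symbol_gen_mul, ih, hamDeriv_X_pow, if_neg (swap_ne a).symm, smul_zero,
      add_zero, pow_succ']

lemma symbol_algebraMap (c : K) : symbol (algebraMap K W c) = C c := by
  rw [Algebra.algebraMap_eq_smul_one, map_smul, symbol_one, smul_eq_C_mul, mul_one]

end Symbol

/-! ### The supertrace -/

section Supertrace

variable {K : Type*} [Field K] [CharZero K] {n : ℕ}

local notation "W" => WeylAlgebra K n

/-- The supertrace on the Weyl algebra: the constant term of the Weyl symbol. -/
noncomputable def supertrace : W →ₗ[K] K := lcoeff K 0 ∘ₗ symbol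

lemma supertrace_apply (x : W) : supertrace x = constantCoeff (symbol x) := rfl

lemma supertrace_algebraMap (c : K) : supertrace (algebraMap K W c) = c := by
  rw [supertrace_apply, symbol_algebraMap, constantCoeff_C]

/-- Left and right Moyal multiplications by a variable differ in the sign of the derivation. As the
remaining term has no constant term, the supertrace changes sign. -/
lemma supertrace_gen_mul (a : Fin n ⊕ Fin n) (x : W) :
    supertrace (gen K n a * x) = -supertrace (x * gen K n a) := by
  simp [supertrace_apply, symbol_gen_mul, symbol_mul_gen, constantCoeff_smul]

lemma supertrace_mul {i : ZMod 2} {x : W} (hx : x ∈ parity K n i) (y : W) :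
    supertrace (x * y) = (-1 : K) ^ i.val * supertrace (y * x) := by
  induction hx using Submodule.span_induction with
  | mem x h =>
    obtain ⟨l, rfl, rfl⟩ := h
    have hpow : ∀ k : ℕ, (-1 : K) ^ (k : ZMod 2).val = (-1) ^ k := fun k => by
      rw [ZMod.val_natCast, ← neg_one_pow_eq_pow_mod_two]
    rw [hpow]
    induction l generalizing y with
    | nil => simp
    | cons a l ih =>
      rw [List.map_cons, List.prod_cons, mul_assoc, supertrace_gen_mul, mul_assoc, ih,
        ← mul_assoc, List.length_cons, pow_succ]
      ring
  | zero => simp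
  | add u v _ _ hu hv => rw [add_mul, mul_add, map_add, map_add, hu, hv, mul_add]
  | smul c u _ hu => rw [smul_mul_assoc, mul_smul_comm, map_smul, map_smul, hu, smul_eq_mul,
      smul_eq_mul, mul_left_comm]

lemma supertrace_odd {x : W} (hx : x ∈ parity K n 1) : supertrace x = 0 := by
  have h := supertrace_mul hx 1
  have hv : (1 : ZMod 2).val = 1 := rfl
  rw [mul_one, one_mul, hv, pow_one, neg_one_mul] at h
  exact self_eq_neg.1 h

lemma supertrace_mul_comm {i j : ZMod 2} {x y : W} (hx : x ∈ parity K n i)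
    (hy : y ∈ parity K n j) :
    supertrace (x * y) = (-1 : K) ^ (i.val * j.val) * supertrace (y * x) := by
  have h2 : ∀ a : ZMod 2, a = 0 ∨ a = 1 := by decide
  have hv1 : (1 : ZMod 2).val = 1 := rfl
  have hv0 : (0 : ZMod 2).val = 0 := rfl
  have h := supertrace_mul hx y
  rcases h2 i with rfl | rfl
  · simpa [hv0] using h
  rcases h2 j with rfl | rfl
  · rw [supertrace_odd (by simpa using SetLike.mul_mem_graded hx hy),
      supertrace_odd (by simpa using SetLike.mul_mem_graded hy hx), mul_zero]
  · simpa [hv1] using h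

/-- The radical of the form `supertrace (x * y)` is a two-sided ideal, so its symbols form a
subspace that is stable under derivatives. -/
lemma eq_zero_of_supertrace_mul_eq_zero {x : W} (hx : ∀ y, supertrace (x * y) = 0) : x = 0 := by
  let J : Submodule K W :=
    { carrier := {x | ∀ y, supertrace (x * y) = 0}
      zero_mem' := by simp
      add_mem' := fun {a b} ha hb y => by rw [add_mul, map_add, ha y, hb y, add_zero]
      smul_mem' := fun c a ha y => by rw [smul_mul_assoc, map_smul, ha y, smul_zero] }
  have hJ : ∀ a, ∀ u ∈ J, gen K n a * u - u * gen K n a ∈ J := by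
    intro a u hu y
    rw [sub_mul, map_sub, mul_assoc, supertrace_gen_mul, mul_assoc, mul_assoc, hu, hu, neg_zero,
      sub_zero]
  refine symbol_injective ((eq_zero_of_pderiv_mem (N := J.map symbol) ?_ ?_
    (Submodule.mem_map_of_mem (show x ∈ J from hx))).trans (map_zero symbol).symm)
  · rintro i _ ⟨u, hu, rfl⟩
    rw [pderiv_eq_hamDeriv, hamDeriv_symbol]
    exact Submodule.neg_mem _ (Submodule.smul_mem _ _ (Submodule.mem_map_of_mem (hJ _ u hu)))
  · rintro _ ⟨u, hu, rfl⟩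
    simpa [supertrace_apply] using hu 1

end Supertrace

end WeylAlgebra

/-! ### The Lie superalgebra structure of the Weyl algebra -/

namespace WeylAlgebra

open MvPolynomial

section LieSuperalgebra

variable {K : Type*} [Field K] {n : ℕ}

local notation "S" => MvPolynomial (Fin n ⊕ Fin n) K
local notation "W" => WeylAlgebra K n

lemma bracket_of_mem {i j : ZMod 2} {x y : W} (hx : x ∈ parity K n i) (hy : y ∈ parity K n j) :
    (lieSuperalgebra K n).bracket x y = x * y - (-1 : K) ^ (i.val * j.val) • (y * x) :=
  LieSuperalgebra.superCommutator_apply _ hx hy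

lemma bracket_of_even {x : W} (hx : x ∈ parity K n 0) (y : W) :
    (lieSuperalgebra K n).bracket x y = x * y - y * x := by
  obtain ⟨a, ha, b, hb, rfl⟩ := (lieSuperalgebra K n).exists_add y
  rw [map_add, bracket_of_mem hx ha, bracket_of_mem hx hb]
  simp [mul_add, add_mul]
  abel

lemma bracket_of_odd_of_even {x y : W} (hx : x ∈ parity K n 1) (hy : y ∈ parity K n 0) :
    (lieSuperalgebra K n).bracket x y = x * y - y * x := by
  rw [bracket_of_mem hx hy, ZMod.val_zero, mul_zero, pow_zero, one_smul]

lemma bracket_of_odd {x y : W} (hx : x ∈ parity K n 1) (hy : y ∈ parity K n 1) :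
    (lieSuperalgebra K n).bracket x y = x * y + y * x := by
  have hv : (1 : ZMod 2).val = 1 := rfl
  rw [bracket_of_mem hx hy, hv, mul_one, pow_one, neg_smul, one_smul, sub_neg_eq_add]

lemma gen_pow_mem_parity (a : Fin n ⊕ Fin n) (k : ℕ) : gen K n a ^ k ∈ parity K n k := by
  simpa using prod_mem_parity (K := K) (List.replicate k a)

lemma gen_pow_mem_parity_one (a : Fin n ⊕ Fin n) {k : ℕ} (hk : Odd k) :
    gen K n a ^ k ∈ parity K n 1 :=
  (ZMod.natCast_eq_one_iff_odd.2 hk) ▸ gen_pow_mem_parity a k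

lemma gen_pow_mem_parity_zero (a : Fin n ⊕ Fin n) {k : ℕ} (hk : Even k) :
    gen K n a ^ k ∈ parity K n 0 :=
  (ZMod.natCast_eq_zero_iff_even.2 hk) ▸ gen_pow_mem_parity a k

lemma gen_mul_gen_mem_parity_zero (a b : Fin n ⊕ Fin n) :
    gen K n a * gen K n b ∈ parity K n 0 :=
  (by decide : (1 + 1 : ZMod 2) = 0) ▸ SetLike.mul_mem_graded (gen_mem_parity a) (gen_mem_parity b)

variable [CharZero K]

lemma bracket_gen_swap_gen_pow (a : Fin n ⊕ Fin n) {k : ℕ} (hk : Odd k) :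
    (lieSuperalgebra K n).bracket (gen K n a.swap) (gen K n a ^ (k + 1)) =
      (sgn K a.swap * (k + 1 : ℕ)) • gen K n a ^ k := by
  refine symbol_injective ?_
  rw [bracket_of_odd_of_even (gen_mem_parity _) (gen_pow_mem_parity_zero a hk.add_one),
    ← hamDeriv_symbol, symbol_gen_pow, hamDeriv_X_pow, Sum.swap_swap, if_pos rfl,
    add_tsub_cancel_right, map_smul, symbol_gen_pow]

lemma sgn_mul_natCast_ne_zero (a : Fin n ⊕ Fin n) (k : ℕ) : sgn K a * (k + 1 : ℕ) ≠ 0 :=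
  mul_ne_zero (sgn_ne_zero a) (Nat.cast_ne_zero.2 k.succ_ne_zero)

lemma gen_pow_mem_derived (a : Fin n ⊕ Fin n) {k : ℕ} (hk : Odd k) :
    gen K n a ^ k ∈ (lieSuperalgebra K n).derivedSubmodule := by
  rw [← Submodule.smul_mem_iff _ (sgn_mul_natCast_ne_zero (K := K) a.swap k),
    ← bracket_gen_swap_gen_pow a hk]
  exact LieSuperalgebra.bracket_mem_derivedSubmodule _ _ _

lemma gen_mem_derived (a : Fin n ⊕ Fin n) :
    gen K n a ∈ (lieSuperalgebra K n).derivedSubmodule := by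
  simpa using gen_pow_mem_derived (K := K) a odd_one

lemma gen_pow_four_mem_derived (a : Fin n ⊕ Fin n) :
    gen K n a ^ 4 ∈ (lieSuperalgebra K n).derivedSubmodule := by
  have h : (lieSuperalgebra K n).bracket (gen K n a) (gen K n a ^ 3) = (2 : K) • gen K n a ^ 4 := by
    rw [bracket_of_odd (gen_mem_parity a) (gen_pow_mem_parity_one a (k := 3) ⟨1, rfl⟩), ← pow_succ,
      ← pow_succ', two_smul]
  rw [← Submodule.smul_mem_iff _ (two_ne_zero (α := K)), ← h]
  exact LieSuperalgebra.bracket_mem_derivedSubmodule _ _ _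

lemma supertrace_bracket (x y : W) : supertrace ((lieSuperalgebra K n).bracket x y) = 0 := by
  obtain ⟨a, ha, b, hb, rfl⟩ := (lieSuperalgebra K n).exists_add x
  obtain ⟨c, hc, d, hd, rfl⟩ := (lieSuperalgebra K n).exists_add y
  have h : ∀ {i j : ZMod 2} {x y : W}, x ∈ parity K n i → y ∈ parity K n j →
      supertrace ((lieSuperalgebra K n).bracket x y) = 0 := fun hx hy => by
    rw [bracket_of_mem hx hy, map_sub, map_smul, smul_eq_mul, supertrace_mul_comm hx hy, sub_self]
  simp only [map_add, LinearMap.add_apply, h ha hc, h ha hd, h hb hc, h hb hd, add_zero]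

lemma supertrace_of_mem_derived {x : W} (hx : x ∈ (lieSuperalgebra K n).derivedSubmodule) :
    supertrace x = 0 := by
  induction hx using Submodule.span_induction with
  | mem x h => obtain ⟨u, v, rfl⟩ := h; exact supertrace_bracket u v
  | zero => exact map_zero _
  | add x y _ _ hx hy => rw [map_add, hx, hy, add_zero]
  | smul c x _ hx => rw [map_smul, hx, smul_zero]

/-- A nonzero subspace of the kernel of the supertrace that is stable under the adjoint action of
`[W, W]` is the whole kernel. -/
lemma mem_of_supertrace_eq_zero (hn : 1 ≤ n) {J : Submodule K W}
    (hJ : ∀ x ∈ (lieSuperalgebra K n).derivedSubmodule, ∀ y ∈ J,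
      (lieSuperalgebra K n).bracket x y ∈ J)
    (h0 : ∀ x ∈ J, supertrace x = 0) (hne : J ≠ ⊥) {x : W} (hx : supertrace x = 0) : x ∈ J := by
  -- The hypotheses of the irreducibility result are checked for the space of symbols of `J`.
  have hmem : ∀ {u : W}, symbol u ∈ J.map symbol ↔ u ∈ J :=
    fun {u} => ⟨fun ⟨_, hv, h⟩ => symbol_injective h ▸ hv, Submodule.mem_map_of_mem⟩
  rw [← hmem]
  refine mem_of_constantCoeff_eq_zero ?_ ?_ ?_ ?_ ?_ ?_ hn hx
  · rintro a b _ ⟨u, hu, rfl⟩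
    have h := hJ _ ((lieSuperalgebra K n).bracket_mem_derivedSubmodule (gen K n a) (gen K n b)) u hu
    have hpar : gen K n a * gen K n b + gen K n b * gen K n a ∈ parity K n 0 :=
      add_mem (gen_mul_gen_mem_parity_zero a b) (gen_mul_gen_mem_parity_zero b a)
    rw [bracket_of_odd (gen_mem_parity a) (gen_mem_parity b), bracket_of_even hpar] at h
    rw [hamDeriv_symbol, hamDeriv_symbol, X_mul_symbol, X_mul_symbol, ← smul_add, ← map_add,
      ← map_smul, hmem]
    convert J.smul_mem (1 / 2) h using 2
    noncomm_ring
  · rintro a _ ⟨u, hu, rfl⟩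
    have h := hJ _ (gen_pow_four_mem_derived a) u hu
    rw [bracket_of_even (gen_pow_mem_parity_zero a ⟨2, rfl⟩)] at h
    rw [hamDeriv_symbol, hamDeriv_symbol, hamDeriv_symbol, pow_succ, pow_two, mul_assoc, mul_assoc,
      X_mul_symbol, ← map_smul, X_mul_symbol, ← map_smul, X_mul_symbol, X_mul_symbol,
      ← map_smul, ← map_smul, ← map_smul, ← map_add, hmem]
    convert h using 1
    simp only [mul_smul_comm, smul_mul_assoc, mul_add, add_mul, mul_sub, sub_mul, pow_succ,
      pow_zero, one_mul, mul_assoc]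
    module
  · intro c d e hd he h
    rw [← symbol_gen_pow, hmem] at h ⊢
    have h' := hJ _ (gen_pow_mem_derived c he) _ h
    rwa [bracket_of_odd (gen_pow_mem_parity_one c he) (gen_pow_mem_parity_one c hd), ← pow_add,
      ← pow_add, add_comm e, ← two_smul K, Submodule.smul_mem_iff _ two_ne_zero] at h'
  · intro c d hd h
    rw [← symbol_gen_pow, hmem] at h ⊢
    have h' := hJ _ (gen_mem_derived c.swap) _ h
    rwa [bracket_gen_swap_gen_pow c hd, Submodule.smul_mem_iff _ (sgn_mul_natCast_ne_zero _ _)] at h'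
  · rintro _ ⟨u, hu, rfl⟩
    exact h0 u hu
  · rwa [← Submodule.map_bot symbol,
      (Submodule.map_injective_of_injective symbol_injective).ne_iff]

lemma gen_ne_zero (a : Fin n ⊕ Fin n) : gen K n a ≠ 0 := fun h => by
  have := symbol_gen (K := K) a
  rw [h, map_zero] at this
  exact X_ne_zero a this.symm

/-- `[W, W]` is itself stable under its adjoint action, so it is the kernel of the supertrace. -/
lemma mem_derived_iff (hn : 1 ≤ n) {x : W} :
    x ∈ (lieSuperalgebra K n).derivedSubmodule ↔ supertrace x = 0 := by
  refine ⟨supertrace_of_mem_derived, mem_of_supertrace_eq_zero hn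
    (fun _ _ _ _ => LieSuperalgebra.bracket_mem_derivedSubmodule _ _ _)
    (fun _ => supertrace_of_mem_derived) ?_⟩
  intro h
  have := gen_mem_derived (K := K) (Sum.inl ⟨0, hn⟩ : Fin n ⊕ Fin n)
  rw [h] at this
  exact gen_ne_zero _ ((Submodule.mem_bot K).1 this)

lemma derived_isSimple (hn : 1 ≤ n) : (lieSuperalgebra K n).derived.IsSimple := by
  have hg := gen_mem_derived (K := K) (Sum.inl ⟨0, hn⟩ : Fin n ⊕ Fin n)
  refine ⟨⟨⟨_, hg⟩, ⟨_, hg⟩, fun h => ?_⟩, fun I hI => ?_⟩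
  · replace h : (lieSuperalgebra K n).bracket _ _ = 0 := congrArg Subtype.val h
    rw [bracket_of_odd (gen_mem_parity _) (gen_mem_parity _), ← two_smul K, ← pow_two] at h
    have h2 := congrArg symbol ((smul_eq_zero_iff_right two_ne_zero).1 h)
    rw [symbol_gen_pow, map_zero] at h2
    exact pow_ne_zero 2 (X_ne_zero _) h2
  · refine or_iff_not_imp_left.2 fun hne => ?_
    rw [eq_top_iff]
    rintro ⟨x, hx⟩ -
    have h := mem_of_supertrace_eq_zero hn
      (J := I.map (lieSuperalgebra K n).derivedSubmodule.subtype) ?_ ?_ ?_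
      (supertrace_of_mem_derived hx)
    · obtain ⟨y, hy, rfl⟩ := h
      exact hy
    · rintro x hx _ ⟨y, hy, rfl⟩
      exact ⟨_, hI ⟨x, hx⟩ y hy, rfl⟩
    · rintro _ ⟨y, -, rfl⟩
      exact supertrace_of_mem_derived y.2
    · rwa [← Submodule.map_bot (lieSuperalgebra K n).derivedSubmodule.subtype,
        (Submodule.map_injective_of_injective (Submodule.injective_subtype _)).ne_iff]

/-- The supertrace form `(x, y) ↦ supertrace (x * y)`. -/
noncomputable def superform : W →ₗ[K] W →ₗ[K] K := (LinearMap.mul K W).compr₂ supertrace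

lemma superform_apply (x y : W) : superform x y = supertrace (x * y) := rfl

lemma superform_isEvenForm : (lieSuperalgebra K n).IsEvenForm superform := by
  intro i j x y hx hy hij
  refine supertrace_odd ?_
  have hij' : i + j = 1 := (by decide : ∀ i j : ZMod 2, i ≠ j → i + j = 1) i j hij
  exact hij' ▸ SetLike.mul_mem_graded hx hy

lemma superform_isSupersymmetric : (lieSuperalgebra K n).IsSupersymmetric superform := by
  intro i j x y hx hy
  rw [superform_apply, superform_apply, mul_comm i.val, supertrace_mul_comm hy hx]

lemma superform_isInvariant : (lieSuperalgebra K n).IsInvariant superform := by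
  intro i j x y z hx hy
  have key : ∀ {k : ZMod 2} {z : W}, z ∈ parity K n k →
      superform ((lieSuperalgebra K n).bracket x y) z +
        (-1 : K) ^ (i.val * j.val) * superform y ((lieSuperalgebra K n).bracket x z) = 0 := by
    intro k z hz
    have hc := supertrace_mul_comm hx (SetLike.mul_mem_graded hy hz)
    have hs : (-1 : K) ^ (i.val * (j + k).val) =
        (-1) ^ (i.val * j.val) * (-1) ^ (i.val * k.val) := by
      rw [ZMod.val_add, ← pow_add, ← mul_add, pow_mul, pow_mul]
      rcases neg_one_pow_eq_or K i.val with h | h <;> rw [h]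
      · simp
      · rw [← neg_one_pow_eq_pow_mod_two]
    rw [hs] at hc
    rw [superform_apply, superform_apply, bracket_of_mem hx hy, bracket_of_mem hx hz]
    simp only [sub_mul, mul_sub, smul_mul_assoc, mul_smul_comm, map_sub, map_smul, smul_eq_mul,
      ← mul_assoc] at hc ⊢
    rw [hc]
    ring
  obtain ⟨a, ha, b, hb, rfl⟩ := (lieSuperalgebra K n).exists_add z
  have h := congrArg₂ (· + ·) (key ha) (key hb)
  simp only [map_add, add_zero] at h ⊢
  rw [← h]
  ring

/-- The left and the right radical of the supertrace form agree, as they pair in the same way,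
up to sign, with homogeneous elements. -/
lemma eq_zero_of_supertrace_mul_eq_zero' {y : W} (hy : ∀ x, supertrace (x * y) = 0) : y = 0 := by
  have key : ∀ {i : ZMod 2} {x : W}, x ∈ parity K n i → supertrace (y * x) = 0 := fun hx =>
    (mul_eq_zero.1 ((supertrace_mul hx y).symm.trans (hy _))).resolve_left
      (pow_ne_zero _ (neg_ne_zero.2 one_ne_zero))
  refine eq_zero_of_supertrace_mul_eq_zero fun x => ?_
  obtain ⟨a, ha, b, hb, rfl⟩ := (lieSuperalgebra K n).exists_add x
  rw [mul_add, map_add, key ha, key hb, add_zero]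

theorem isSuperquadratic : (lieSuperalgebra K n).IsSuperquadratic :=
  ⟨superform, ⟨fun _ hx => eq_zero_of_supertrace_mul_eq_zero hx,
    fun _ hy => eq_zero_of_supertrace_mul_eq_zero' hy⟩, superform_isEvenForm, superform_isSupersymmetric,
    superform_isInvariant⟩

/-- As `W = K ⊕ [W, W]` and the two summands are orthogonal, the supertrace form restricts to a
nondegenerate form on `[W, W]`. -/
theorem derived_isSuperquadratic (hn : 1 ≤ n) :
    (lieSuperalgebra K n).derived.IsSuperquadratic := by
  have hsub : ∀ y : W, y - algebraMap K W (supertrace y) ∈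
      (lieSuperalgebra K n).derivedSubmodule := fun y => by
    rw [mem_derived_iff hn, map_sub, supertrace_algebraMap, sub_self]
  refine ⟨superform.domRestrict₁₂ _ _, ⟨?_, ?_⟩, fun _ _ _ _ hx hy => superform_isEvenForm hx hy,
    fun _ _ _ _ hx hy => superform_isSupersymmetric hx hy,
    fun _ _ _ _ z hx hy => superform_isInvariant (z : W) hx hy⟩
  · rintro ⟨x, hx⟩ h
    refine Subtype.ext (eq_zero_of_supertrace_mul_eq_zero fun y => ?_)
    have h1 : supertrace (x * (y - algebraMap K W (supertrace y))) = 0 := h ⟨_, hsub y⟩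
    rwa [mul_sub, map_sub, ← Algebra.commutes, ← Algebra.smul_def, map_smul,
      supertrace_of_mem_derived hx, smul_zero, sub_zero] at h1
  · rintro ⟨x, hx⟩ h
    refine Subtype.ext (eq_zero_of_supertrace_mul_eq_zero' fun y => ?_)
    have h1 : supertrace ((y - algebraMap K W (supertrace y)) * x) = 0 := h ⟨_, hsub y⟩
    rwa [sub_mul, map_sub, ← Algebra.smul_def, map_smul,
      supertrace_of_mem_derived hx, smul_zero, sub_zero] at h1

end LieSuperalgebra

end WeylAlgebra

theorem corollary4p2 {K : Type*} [Field K] [CharZero K] (n : ℕ) (hn : 1 ≤ n) :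
    (WeylAlgebra.lieSuperalgebra K n).IsSuperquadratic ∧
      (WeylAlgebra.lieSuperalgebra K n).derived.IsSuperquadratic ∧
      (WeylAlgebra.lieSuperalgebra K n).derived.IsSimple :=
  ⟨WeylAlgebra.isSuperquadratic, WeylAlgebra.derived_isSuperquadratic hn,
    WeylAlgebra.derived_isSimple hn⟩
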